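/- Let $A$ be a closed, densely defined, symmetric operator in a complex Hilbert space $\mathcal H$, and let $T\subset A^*$ be a linear operator with $\overline T=A^*$. Let $\{\mathcal G,\Gamma_0,\Gamma_1\}$ be a quasi boundary triple for $T\subset A^*$; that is, $\mathcal G$ is a Hilbert space, $\Gamma_0,\Gamma_1:\operatorname{dom}T\to\mathcal G$ are linear maps such that $$(Tf,g)_{\mathcal H}-(f,Tg)_{\mathcal H}=(\Gamma_1f,\Gamma_0g)_{\mathcal G}-(\Gamma_0f,\Gamma_1g)_{\mathcal G},\qquad f,g\in\operatorname{dom}T,$$ the map $\Gamma=(\Gamma_0,\Gamma_1)^\top:\operatorname{dom}T\to\mathcal G\times\mathcal G$ has dense range, and $A_0:=T\upharpoonright\ker\Gamma_0$ is self-adjoint in $\mathcal H$. Assume that $A_1:=T\upharpoonright\ker\Gamma_1$ is self-adjoint as well, and let $\eta\in\rho(A_0)\cap\rho(A_1)\cap\mathbb R$. Let $M(\eta)=\Gamma_1\bigl(\Gamma_0\upharpoonright\ker(T-\eta)\bigr)^{-1}$, with domain $\operatorname{ran}\Gamma_0$, be the value at $\eta$ of the Weyl function of the triple. Suppose that the spaces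 $$\mathscr G_0:=\operatorname{ran}(\Gamma_0\upharpoonright\ker\Gamma_1),\qquad \mathscr G_1:=\operatorname{ran}(\Gamma_1\upharpoonright\ker\Gamma_0)$$ are dense in $\mathcal G$. Equip $\mathscr G_0$ and $\mathscr G_1$ with norms $\|\cdot\|_{\mathscr G_0}$, $\|\cdot\|_{\mathscr G_1}$ which make them reflexive Banach spaces continuously embedded in $\mathcal G$ and for which $\Gamma_0(A_1-\bar\lambda)^{-1}:\mathcal H\to\mathscr G_0$ is continuous for some $\lambda\in\rho(A_1)$ and $\Gamma_1(A_0-\bar\mu)^{-1}:\mathcal H\to\mathscr G_1$ is continuous for some $\mu\in\rho(A_0)$. Let $\mathscr G_1'$ be the anti-dual space of $\mathscr G_1$; an element $x\in\mathcal G$ is regarded as the element $y\mapsto(x,y)_{\mathcal G}$ of $\mathscr G_1'$. The operator $M(\eta)$ maps $\mathscr G_0$ into $\mathscr G_1$. Let $\vartheta$ be a symmetric operator in $\mathcal G$ such that $\mathscr G_0\subset\operatorname{dom}\vartheta$ and $\vartheta(\mathscr G_0)\subset\mathscr G_1$, and assume that one of the following conditions holds: (i) $\vartheta$, regarded as an operator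 from $\mathscr G_0$ to $\mathscr G_1$, is compact; (ii) $\vartheta$, regarded as an operator from $\mathscr G_0$ to $\mathscr G_1$, is relatively compact with respect to $M(\eta)$, regarded as an operator from $\mathscr G_0$ to $\mathscr G_1$; that is, for every sequence $(x_k)$ in $\mathscr G_0$ for which $\|x_k\|_{\mathscr G_0}+\|M(\eta)x_k\|_{\mathscr G_1}$ is bounded, $(\vartheta x_k)$ has a subsequence converging in $\mathscr G_1$; (iii) there exist $c_1>0$ and $c_2\in[0,1)$ such that $$\|\vartheta x\|_{\mathscr G_1}\le c_1\|x\|_{\mathscr G_1'}+c_2\|M(\eta)x\|_{\mathscr G_1},\qquad x\in\mathscr G_0.$$ Then the operator $A_\vartheta:=T\upharpoonright\{f\in\operatorname{dom}T:\Gamma f\in\vartheta\}$, where $\vartheta$ is identified with its graph in $\mathcal G\times\mathcal G$, is self-adjoint in $\mathcal H$. -/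

import Mathlib

open Filter Topology

noncomputable section

namespace QBT

/-! ### Restrictions, resolvents and operators between subspaces -/

section Operators

variable {H : Type*} [NormedAddCommGroup H] [InnerProductSpace ℂ H]
variable {G : Type*} [NormedAddCommGroup G] [InnerProductSpace ℂ G]

/-- The restriction `T ↾ S` of a (possibly unbounded) operator `T` in `H` to a linear subspace `S`
of its domain. -/
def restr (T : H →ₗ.[ℂ] H) (S : Submodule ℂ T.domain) : H →ₗ.[ℂ] H where
  domain := S.map T.domain.subtype
  toFun := T.toFun ∘ₗ Submodule.inclusion (Submodule.map_subtype_le _ _)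

/-- An element of `dom (T ↾ S)`, viewed as an element of `dom T`. -/
def restrIncl (T : H →ₗ.[ℂ] H) (S : Submodule ℂ T.domain) : (restr T S).domain →ₗ[ℂ] T.domain :=
  Submodule.inclusion (Submodule.map_subtype_le _ _)

lemma restrIncl_mem (T : H →ₗ.[ℂ] H) (S : Submodule ℂ T.domain) (f : (restr T S).domain) :
    restrIncl T S f ∈ S := by
  obtain ⟨f, hf⟩ := f
  obtain ⟨g, hg, rfl⟩ := hf
  exact hg

/-- The map `f ↦ T f - z f` on `dom T`. -/
def shift (T : H →ₗ.[ℂ] H) (z : ℂ) : T.domain →ₗ[ℂ] H :=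
  T.toFun - z • T.domain.subtype

/-- The resolvent set of an operator in `H`: the points `z` such that `(S - z)⁻¹` is a bounded
operator defined on all of `H`. -/
def resolventSet (S : H →ₗ.[ℂ] H) : Set ℂ :=
  {z | Function.Bijective (shift S z) ∧ ∃ C : ℝ, ∀ f : S.domain, ‖(f : H)‖ ≤ C * ‖shift S z f‖}

/-- The resolvent `(S - z)⁻¹ : H → dom S`. -/
def resolvent {S : H →ₗ.[ℂ] H} {z : ℂ} (hz : z ∈ resolventSet S) : H ≃ₗ[ℂ] S.domain :=
  (LinearEquiv.ofBijective (shift S z) hz.1).symm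

/-- An operator `S` in `G` with `p ⊆ dom S` and `S p ⊆ q`, regarded as an operator from `p`
to `q`. -/
def between (S : G →ₗ.[ℂ] G) (p q : Submodule ℂ G) (hdom : p ≤ S.domain)
    (hran : ∀ x (hx : x ∈ p), S ⟨x, hdom hx⟩ ∈ q) : p →ₗ[ℂ] q :=
  LinearMap.codRestrict q (S.toFun ∘ₗ Submodule.inclusion hdom) fun x => hran x x.2

end Operators

/-! ### Quasi boundary triples -/

section Triples

variable {H : Type*} [NormedAddCommGroup H] [InnerProductSpace ℂ H]
variable {G : Type*} [NormedAddCommGroup G] [InnerProductSpace ℂ G]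

/-- `{G, Γ₀, Γ₁}` is a quasi boundary triple for `T ⊆ A*`, where the closure of `T` is `A*`. -/
structure IsQuasiBoundaryTriple [CompleteSpace H] (A T : H →ₗ.[ℂ] H)
    (Γ₀ Γ₁ : T.domain →ₗ[ℂ] G) : Prop where
  le_adjoint : T ≤ A.adjoint
  closure_eq : T.closure = A.adjoint
  green : ∀ f g : T.domain,
    inner ℂ (T f) (g : H) - inner ℂ (f : H) (T g)
      = inner ℂ (Γ₁ f) (Γ₀ g) - inner ℂ (Γ₀ f) (Γ₁ g)
  denseRange : DenseRange fun f : T.domain => (Γ₀ f, Γ₁ f)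
  selfAdjoint : IsSelfAdjoint (restr T Γ₀.ker)

/-- The space `ran (Γ ↾ ker Γ')`. Thus `𝒢₀ = kerRange Γ₀ Γ₁` and `𝒢₁ = kerRange Γ₁ Γ₀`. -/
def kerRange {T : H →ₗ.[ℂ] H} (Γ Γ' : T.domain →ₗ[ℂ] G) : Submodule ℂ G :=
  Γ'.ker.map Γ

/-- The defect space `ker (T - z)`. -/
def defect (T : H →ₗ.[ℂ] H) (z : ℂ) : Submodule ℂ T.domain :=
  (shift T z).ker

lemma bijective_on_defect {T : H →ₗ.[ℂ] H} (Γ₀ : T.domain →ₗ[ℂ] G) {z : ℂ}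
    (hz : z ∈ resolventSet (restr T Γ₀.ker)) :
    Function.Bijective (Γ₀.rangeRestrict ∘ₗ (defect T z).subtype) := by
  constructor
  · rw [injective_iff_map_eq_zero]
    rintro ⟨f, hf⟩ h
    have h0 : Γ₀ f = 0 := congrArg Subtype.val h
    have h1 : (⟨f, Submodule.mem_map_of_mem (f := T.domain.subtype) h0⟩ :
        (restr T Γ₀.ker).domain) = 0 :=
      hz.1.1 (by rw [map_zero]; exact hf)
    have h2 : (f : H) = 0 := congrArg Subtype.val h1
    exact Subtype.ext (Subtype.ext h2)
  · rintro ⟨_, f, rfl⟩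
    obtain ⟨g, hg⟩ := hz.1.2 (shift T z f)
    refine ⟨⟨f - restrIncl T _ g, ?_⟩, ?_⟩
    · change shift T z (f - restrIncl T _ g) = 0
      rw [map_sub, sub_eq_zero]
      exact hg.symm
    · ext
      have : Γ₀ (restrIncl T _ g) = 0 := restrIncl_mem T _ g
      simp [this]

/-- The values `γ(z) = (Γ₀ ↾ ker (T - z))⁻¹` of the `γ`-field, `z ∈ ρ(A₀)`. -/
def gammaField {T : H →ₗ.[ℂ] H} (Γ₀ : T.domain →ₗ[ℂ] G) {z : ℂ}
    (hz : z ∈ resolventSet (restr T Γ₀.ker)) : Γ₀.range ≃ₗ[ℂ] defect T z :=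
  (LinearEquiv.ofBijective _ (bijective_on_defect Γ₀ hz)).symm

/-- The values `M(z) = Γ₁ γ(z)` of the Weyl function, `z ∈ ρ(A₀)`, as operators in `G` with
domain `ran Γ₀`. -/
def weyl {T : H →ₗ.[ℂ] H} (Γ₀ Γ₁ : T.domain →ₗ[ℂ] G) {z : ℂ}
    (hz : z ∈ resolventSet (restr T Γ₀.ker)) : G →ₗ.[ℂ] G where
  domain := Γ₀.range
  toFun := Γ₁ ∘ₗ (defect T z).subtype ∘ₗ (gammaField Γ₀ hz).toLinearMap

lemma kerRange_le_weyl_domain {T : H →ₗ.[ℂ] H} (Γ₀ Γ₁ : T.domain →ₗ[ℂ] G) {z : ℂ}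
    (hz : z ∈ resolventSet (restr T Γ₀.ker)) : kerRange Γ₀ Γ₁ ≤ (weyl Γ₀ Γ₁ hz).domain := by
  rintro _ ⟨f, -, rfl⟩
  exact ⟨f, rfl⟩

lemma weyl_mem_kerRange {T : H →ₗ.[ℂ] H} (Γ₀ Γ₁ : T.domain →ₗ[ℂ] G) {z : ℂ}
    (hz : z ∈ resolventSet (restr T Γ₀.ker)) (x : G) (hx : x ∈ kerRange Γ₀ Γ₁) :
    weyl Γ₀ Γ₁ hz ⟨x, kerRange_le_weyl_domain Γ₀ Γ₁ hz hx⟩ ∈ kerRange Γ₁ Γ₀ := by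
  obtain ⟨f, hf, rfl⟩ := hx
  set y : Γ₀.range := ⟨Γ₀ f, ⟨f, rfl⟩⟩ with hy
  have h1 : Γ₀ (gammaField Γ₀ hz y : T.domain) = Γ₀ f :=
    congrArg Subtype.val
      ((LinearEquiv.ofBijective _ (bijective_on_defect Γ₀ hz)).apply_symm_apply y)
  refine ⟨(gammaField Γ₀ hz y : T.domain) - f, ?_, ?_⟩
  · change Γ₀ _ = 0
    rw [map_sub, h1, sub_self]
  · have : Γ₁ f = 0 := hf
    rw [map_sub, this, sub_zero]
    rfl

/-- `M(z)` regarded as an operator from `𝒢₀` to `𝒢₁`. -/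
def weylBetween {T : H →ₗ.[ℂ] H} (Γ₀ Γ₁ : T.domain →ₗ[ℂ] G) {z : ℂ}
    (hz : z ∈ resolventSet (restr T Γ₀.ker)) : kerRange Γ₀ Γ₁ →ₗ[ℂ] kerRange Γ₁ Γ₀ :=
  between (weyl Γ₀ Γ₁ hz) _ _ (kerRange_le_weyl_domain Γ₀ Γ₁ hz) (weyl_mem_kerRange Γ₀ Γ₁ hz)

/-- The operator `Γ (T ↾ ker Γ' - z)⁻¹ : H → ran (Γ ↾ ker Γ')`. -/
def boundaryResolvent {T : H →ₗ.[ℂ] H} (Γ Γ' : T.domain →ₗ[ℂ] G) {z : ℂ}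
    (hz : z ∈ resolventSet (restr T Γ'.ker)) : H →ₗ[ℂ] kerRange Γ Γ' :=
  LinearMap.codRestrict _ (Γ ∘ₗ restrIncl T _ ∘ₗ (resolvent hz).toLinearMap) fun h =>
    Submodule.mem_map_of_mem (restrIncl_mem T _ (resolvent hz h))

/-- The restriction `A_ϑ` of `T` to `{f ∈ dom T : (Γ₀ f, Γ₁ f) ∈ ϑ}` for an operator `ϑ` in `G`,
identified with its graph. -/
def extension {T : H →ₗ.[ℂ] H} (Γ₀ Γ₁ : T.domain →ₗ[ℂ] G) (ϑ : G →ₗ.[ℂ] G) : H →ₗ.[ℂ] H :=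
  restr T (ϑ.graph.comap (Γ₀.prod Γ₁))

end Triples

/-! ### Norms on subspaces -/

section Norms

variable {G : Type*} [NormedAddCommGroup G] [InnerProductSpace ℂ G]

/-- A norm on the linear subspace `p` of `G` for which the embedding of `p` into `G` is continuous
(so that it is automatically definite). -/
structure EmbeddedNorm (p : Submodule ℂ G) where
  toSeminorm : Seminorm ℂ p
  bound : ∃ C : ℝ, ∀ x : p, ‖(x : G)‖ ≤ C * toSeminorm x

namespace EmbeddedNorm

variable {p : Submodule ℂ G} (N : EmbeddedNorm p)

/-- The subspace `p`, equipped with the norm `N` in place of the norm of `G`. -/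
def Space (_N : EmbeddedNorm p) : Type _ := p

instance : AddCommGroup N.Space := inferInstanceAs (AddCommGroup p)

instance : Module ℂ N.Space := inferInstanceAs (Module ℂ p)

/-- The identity map from `p` with the norm `N` to `p`. -/
def toSub : N.Space ≃ₗ[ℂ] p := LinearEquiv.refl ℂ p

lemma eq_zero_of_seminorm (x : p) (hx : N.toSeminorm x = 0) : x = 0 := by
  obtain ⟨C, hC⟩ := N.bound
  have := hC x
  rw [hx, mul_zero] at this
  exact Subtype.ext (norm_le_zero_iff.1 this)

instance : NormedAddCommGroup N.Space :=
  AddGroupNorm.toNormedAddCommGroup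
    { toFun := fun x => N.toSeminorm (N.toSub x)
      map_zero' := map_zero N.toSeminorm
      add_le' := fun x y => map_add_le_add N.toSeminorm (N.toSub x) (N.toSub y)
      neg' := fun x => map_neg_eq_map N.toSeminorm (N.toSub x)
      eq_zero_of_map_eq_zero' := fun x hx => N.eq_zero_of_seminorm x hx }

lemma norm_def (x : N.Space) : ‖x‖ = N.toSeminorm (N.toSub x) := rfl

instance : NormedSpace ℂ N.Space where
  norm_smul_le c x := (map_smul_eq_mul N.toSeminorm c (N.toSub x)).le

/-- The continuous embedding of `(p, N)` into `G`. -/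
def incl : N.Space →L[ℂ] G where
  toLinearMap := p.subtype ∘ₗ N.toSub.toLinearMap
  cont := by
    obtain ⟨C, hC⟩ := N.bound
    exact AddMonoidHomClass.continuous_of_bound
      (p.subtype ∘ₗ N.toSub.toLinearMap) C fun x => hC (N.toSub x)

/-- The embedding of `G` into the anti-dual of `(p, N)`: the element `x` of `G` acts as the
antilinear functional `y ↦ (x, y)`, where `(·, ·)` is linear in the first argument, that is,
`y ↦ inner ℂ y x`. -/
def toAntidual (x : G) : N.Space →L⋆[ℂ] ℂ :=
  ((innerSL ℂ).flip x).comp N.incl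

/-- The norm of `x ∈ G` in the anti-dual space of `(p, N)`. -/
def antidualNorm (x : G) : ℝ := ‖N.toAntidual x‖

end EmbeddedNorm

/-- A linear map `p → q`, regarded as a linear map between `p` and `q` equipped with the norms
`N` and `N'`. -/
def onSpaces {p q : Submodule ℂ G} (N : EmbeddedNorm p) (N' : EmbeddedNorm q) (L : p →ₗ[ℂ] q) :
    N.Space →ₗ[ℂ] N'.Space :=
  N'.toSub.symm.toLinearMap ∘ₗ L ∘ₗ N.toSub.toLinearMap

/-- Reflexivity of a normed space. -/
def IsReflexiveSpace (X : Type*) [NormedAddCommGroup X] [NormedSpace ℂ X] : Prop :=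
  Function.Surjective (NormedSpace.inclusionInDoubleDual ℂ X)

/-- `θ` is relatively compact with respect to `𝔐` (for operators with the same domain `X`):
`θ` maps every sequence which is bounded in the graph norm of `𝔐` to a sequence with a convergent
subsequence. -/
def RelativelyCompact {X Y Z : Type*} [NormedAddCommGroup X] [NormedSpace ℂ X]
    [NormedAddCommGroup Y] [NormedSpace ℂ Y] [NormedAddCommGroup Z] [NormedSpace ℂ Z]
    (θ : X →ₗ[ℂ] Y) (𝔐 : X →ₗ[ℂ] Z) : Prop :=
  ∀ x : ℕ → X, (∃ C : ℝ, ∀ k, ‖x k‖ + ‖𝔐 (x k)‖ ≤ C) →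
    ∃ (y : Y) (φ : ℕ → ℕ), StrictMono φ ∧ Tendsto (fun k => θ (x (φ k))) atTop (𝓝 y)

/-- The norms admitted on `ran (Γ ↾ ker Γ')`: those which turn it into a reflexive Banach space,
continuously embedded in `G`, such that `Γ (T ↾ ker Γ' - z)⁻¹` is continuous from `H` into it for
some `z` in the resolvent set of `T ↾ ker Γ'`. (This set is symmetric with respect to the real axis
when `T ↾ ker Γ'` is self-adjoint, so that `z` may be replaced by its conjugate.) -/
structure IsAdmissible {H : Type*} [NormedAddCommGroup H] [InnerProductSpace ℂ H]
    {T : H →ₗ.[ℂ] H} (Γ Γ' : T.domain →ₗ[ℂ] G) (N : EmbeddedNorm (kerRange Γ Γ')) : Prop where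
  complete : CompleteSpace N.Space
  reflexive : IsReflexiveSpace N.Space
  continuous_resolvent : ∃ (z : ℂ) (hz : z ∈ resolventSet (restr T Γ'.ker)),
    Continuous fun h : H => N.toSub.symm (boundaryResolvent Γ Γ' hz h)

end Norms

end QBT

end

open Filter Topology

noncomputable section

namespace QBT

/-! ### Symmetric pairs of bounded operators: self-adjointness and invertibility -/

section Abstract

variable {K : Type*} [NormedAddCommGroup K] [InnerProductSpace ℂ K]

/-! The problem is moved to the Hilbert space K, the closure of ker(T - η), where everything is
bounded. By Green's identity, Γ₁(A₀ - η)⁻¹ is the adjoint of γ(η); it restricts to an isomorphism e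
from K onto 𝒢₁ (`exists_equiv`). On K the difference R of the resolvents of A₀ and A₁ at η is
symmetric and injective. Its values lie in ker(T - η), with boundary data Γ₀Rk = xk ∈ 𝒢₀ and Γ₁Rk =
ek, so M(η)xk = ek, and ϑ becomes Q = e⁻¹ϑx. With P the orthogonal projection onto K, the element
(A₀ - η)⁻¹w + Rl lies in dom A_ϑ as soon as Ql - l = Pw. Hence A_ϑ is self-adjoint once the operator
Rk ↦ Qk - k in K is.

By `exists_of_forall_inner_eq` it suffices that 1 - Q ± iR be invertible. Since (Rk, (1 - Q)k) is
real, ‖Rk‖ ≤ ‖(1 - Q ± iR)k‖. Under (i) and (ii) Q is compact, and this estimate with the Fredholm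
alternative suffices (`isUnit_of_isCompactOperator`). Under (iii) the estimate bounds Q relative to
1 - tQ ± iR uniformly in t ∈ [0, 1], and invertibility propagates from t = 0 to t = 1
(`isUnit_of_relative_bound`). The 𝒢₁'-norm enters through (ek, xl) = (k, Rl), which gives ‖xl‖ ≤
‖e⁻¹‖‖Rl‖ in that norm. -/

lemma isCompactOperator_of_subseq {X Y : Type*} [NormedAddCommGroup X] [NormedSpace ℂ X]
    [NormedAddCommGroup Y] [NormedSpace ℂ Y] (f : X →ₗ[ℂ] Y)
    (hf : ∀ x : ℕ → X, (∀ k, ‖x k‖ ≤ 1) →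
      ∃ (y : Y) (φ : ℕ → ℕ), StrictMono φ ∧ Tendsto (fun k => f (x (φ k))) atTop (𝓝 y)) :
    IsCompactOperator f := by
  rw [isCompactOperator_iff_isCompact_closure_image_closedBall f one_pos]
  refine IsSeqCompact.isCompact fun u hu => ?_
  -- Points of the closure are replaced by nearby points of the image; the errors tend to 0, so both
  -- sequences have the same limits.
  have h1 : ∀ n, ∃ x : X, ‖x‖ ≤ 1 ∧ dist (u n) (f x) < 1 / ((n : ℝ) + 1) := fun n => by
    obtain ⟨_, ⟨x, hx, rfl⟩, h⟩ :=
      Metric.mem_closure_iff.1 (hu n) _ (Nat.one_div_pos_of_nat (n := n))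
    exact ⟨x, by simpa using hx, h⟩
  choose x hx hd using h1
  obtain ⟨y, φ, hφ, hy⟩ := hf x hx
  have h2 : Tendsto (fun k => u (φ k)) atTop (𝓝 y) := by
    refine hy.congr_dist ?_
    refine squeeze_zero (fun _ => dist_nonneg) (fun k => ?_)
      (tendsto_one_div_add_atTop_nhds_zero_nat.comp hφ.tendsto_atTop)
    rw [dist_comm]
    exact (hd (φ k)).le
  exact ⟨y, isClosed_closure.mem_of_tendsto h2 (Eventually.of_forall fun k => hu (φ k)), φ, hφ, h2⟩

/-- (Rk, Lk) is real, so the imaginary part of (Rk, (L ± iR)k) is ±‖Rk‖²; Cauchy–Schwarz finishes.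
-/
lemma norm_sq_le_of_symmetric_pair {R L : K →L[ℂ] K}
    (h : ∀ k l, inner ℂ (L k) (R l) = inner ℂ (R k) (L l)) {z : ℂ}
    (hz : z = Complex.I ∨ z = -Complex.I) (k : K) : ‖R k‖ ≤ ‖(L + z • R) k‖ := by
  have h1 : (inner ℂ (R k) (L k)).im = 0 := by
    rw [← Complex.conj_eq_iff_im, inner_conj_symm, h]
  have h2 : |(inner ℂ (R k) ((L + z • R) k)).im| = ‖R k‖ ^ 2 := by
    have : (inner ℂ (R k) ((L + z • R) k)) = inner ℂ (R k) (L k) + z * (‖R k‖ ^ 2 : ℝ) := by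
      simp [inner_self_eq_norm_sq_to_K]
    rw [this]
    have hr : 0 ≤ ‖R k‖ ^ 2 := by positivity
    generalize ‖R k‖ ^ 2 = r at hr
    rcases hz with rfl | rfl <;> simp [h1, abs_of_nonneg hr]
  have h3 : ‖R k‖ ^ 2 ≤ ‖R k‖ * ‖(L + z • R) k‖ := by
    rw [← h2]
    exact (Complex.abs_im_le_norm _).trans (norm_inner_le_norm _ _)
  rcases (norm_nonneg (R k)).eq_or_lt with h0 | h0
  · rw [← h0]; positivity
  · rw [sq] at h3
    exact le_of_mul_le_mul_left h3 h0

/-- The operator `R k ↦ Q k - k` is self-adjoint if `1 - Q ± i R` are invertible. -/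
lemma exists_of_forall_inner_eq {R Q : K →L[ℂ] K}
    (hR : ∀ k l, inner ℂ (R k) l = inner ℂ k (R l))
    (hQR : ∀ k l, inner ℂ (Q k) (R l) = inner ℂ (R k) (Q l))
    (h : ∀ z : ℂ, z = Complex.I ∨ z = -Complex.I → IsUnit (1 - Q + z • R))
    {u w : K} (huw : ∀ k, inner ℂ (Q k - k) u = inner ℂ (R k) w) :
    ∃ l, R l = u ∧ Q l - l = w := by
  have surj : ∀ z : ℂ, z = Complex.I ∨ z = -Complex.I → ∀ v, ∃ k, (1 - Q + z • R) k = v := by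
    intro z hz v
    obtain ⟨U, hU⟩ := h z hz
    refine ⟨(↑U⁻¹ : K →L[ℂ] K) v, ?_⟩
    rw [← hU]
    change ((U : K →L[ℂ] K) * (↑U⁻¹ : K →L[ℂ] K)) v = v
    rw [U.mul_inv]; rfl
  -- This l leaves a single error u - Rl, with w = Ql - l + i(u - Rl). Solving the equation at -i
  -- for that error and testing `huw` with the solution shows that it is orthogonal to itself.
  obtain ⟨l, hl⟩ := surj Complex.I (Or.inl rfl) (-w + Complex.I • u)
  have hl' : l - Q l + Complex.I • R l = -w + Complex.I • u := hl
  have hw : w = Q l - l + Complex.I • (u - R l) := by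
    rw [smul_sub]
    linear_combination (norm := module) hl'
  obtain ⟨k, hk⟩ := surj (-Complex.I) (Or.inr rfl) (u - R l)
  have hk' : k - Q k - Complex.I • R k = u - R l := by
    rw [← hk]; simp [sub_eq_add_neg]
  have h0 : inner ℂ (u - R l) (u - R l) = (0 : ℂ) := by
    have h1 := huw k
    rw [hw] at h1
    have h2 : inner ℂ (Q k - k) (R l) = inner ℂ (R k) (Q l - l) := by
      rw [inner_sub_left, inner_sub_right, hQR, ← hR]
    nth_rewrite 1 [← hk']
    rw [inner_add_right, inner_smul_right, ← h2] at h1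
    have h3 : inner ℂ (k - Q k - Complex.I • R k) (u - R l)
        = -(inner ℂ (Q k - k) u - inner ℂ (Q k - k) (R l)) + Complex.I * inner ℂ (R k) (u - R l) := by
      rw [← inner_sub_right, inner_sub_left, inner_smul_left, ← neg_sub (Q k) k, inner_neg_left]
      simp [inner_sub_right]
    rw [h3, h1]; ring
  have hul : u = R l := sub_eq_zero.1 (inner_self_eq_zero.1 h0)
  refine ⟨l, hul.symm, ?_⟩
  rw [hw, hul]; simp

variable [CompleteSpace K]

/-- Since z² = -1, 1 + zR = -z(z - R), and z is not in the real spectrum of R. -/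
lemma isUnit_one_add_smul_of_isSymmetric {R : K →L[ℂ] K}
    (hR : ∀ k l, inner ℂ (R k) l = inner ℂ k (R l)) {z : ℂ} (hz : z = Complex.I ∨ z = -Complex.I) :
    IsUnit (1 + z • R) := by
  have hsa : IsSelfAdjoint R := by
    rw [ContinuousLinearMap.isSelfAdjoint_iff_isSymmetric]
    exact hR
  have hz2 : z * z = -1 := by rcases hz with rfl | rfl <;> simp
  have h1 : IsUnit (algebraMap ℂ (K →L[ℂ] K) z - R) := by
    by_contra hcon
    have := hsa.im_eq_zero_of_mem_spectrum (z := z) hcon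
    rcases hz with rfl | rfl <;> simp at this
  have h2 : (1 + z • R) = (-z) • (algebraMap ℂ (K →L[ℂ] K) z - R) := by
    rw [Algebra.algebraMap_eq_smul_one, smul_sub, smul_smul]
    simp [hz2]
  rw [h2]
  have hz0 : -z ≠ 0 := by rcases hz with rfl | rfl <;> simp
  exact h1.smul (Units.mk0 _ hz0)

lemma isUnit_of_isCompactOperator {R Q : K →L[ℂ] K}
    (hR : ∀ k l, inner ℂ (R k) l = inner ℂ k (R l))
    (hQR : ∀ k l, inner ℂ (Q k) (R l) = inner ℂ (R k) (Q l))
    (hinj : ∀ k, R k = 0 → k = 0) (hQ : IsCompactOperator Q)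
    {z : ℂ} (hz : z = Complex.I ∨ z = -Complex.I) : IsUnit (1 - Q + z • R) := by
  obtain ⟨U, hU⟩ := isUnit_one_add_smul_of_isSymmetric hR hz
  set V : K →L[ℂ] K := (↑U⁻¹ : K →L[ℂ] K) with hV
  have hUV : (1 + z • R) * V = 1 := by rw [← hU, hV, Units.mul_inv]
  have hc : IsCompactOperator (V * Q) := hQ.clm_comp V
  -- With the invertible factor U = 1 + zR split off, only the value 1 in the spectrum of the
  -- compact VQ matters. An eigenvector k would satisfy (1 - Q + zR)k = 0, hence Rk = 0 and k = 0.
  have h1 : 1 - Q + z • R = U * (1 - V * Q) := by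
    rw [mul_sub, ← mul_assoc, hU, hUV]
    simp; abel
  have h2 : (1 : ℂ) ∈ _root_.resolventSet ℂ (V * Q) := by
    refine (hc.hasEigenvalue_or_mem_resolventSet one_ne_zero).resolve_left fun he => ?_
    obtain ⟨k, hk⟩ := he.exists_hasEigenvector
    apply hk.2
    have h3 : (V * Q) k = k := by simpa using hk.apply_eq_smul
    have h4 : (1 - Q + z • R) k = 0 := by
      rw [h1]
      change (U : K →L[ℂ] K) (k - (V * Q) k) = 0
      rw [h3, sub_self, map_zero]
    have h5 := norm_sq_le_of_symmetric_pair (R := R) (L := 1 - Q) (fun k l => by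
      simp [hQR, hR]) hz k
    rw [h4, norm_zero] at h5
    exact hinj k (norm_le_zero_iff.1 h5)
  rw [h1]
  refine U.isUnit.mul ?_
  have := h2
  rw [_root_.spectrum.mem_resolventSet_iff] at this
  simpa using this

lemma isUnit_of_relative_bound {R Q : K →L[ℂ] K}
    (hR : ∀ k l, inner ℂ (R k) l = inner ℂ k (R l))
    (hQR : ∀ k l, inner ℂ (Q k) (R l) = inner ℂ (R k) (Q l))
    {a b : ℝ} (ha : 0 ≤ a) (hb : 0 ≤ b)
    (hQ : ∀ t : ℝ, 0 ≤ t → t ≤ 1 → ∀ k, ‖Q k‖ ≤ a * ‖R k‖ + b * ‖k - (t : ℂ) • Q k‖)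
    {z : ℂ} (hz : z = Complex.I ∨ z = -Complex.I) : IsUnit (1 - Q + z • R) := by
  set m := a + 2 * b with hm
  have hm0 : 0 ≤ m := by positivity
  have hz1 : ‖z‖ = 1 := by rcases hz with rfl | rfl <;> simp
  -- Both ‖Rk‖ and ½‖(1 - tQ)k‖ are at most ‖(1 - tQ + zR)k‖, whence m = a + 2b. Since m does not
  -- depend on t, steps of a fixed length 1/n < 1/m reach t = 1.
  have key : ∀ t : ℝ, 0 ≤ t → t ≤ 1 → ∀ k, ‖Q k‖ ≤ m * ‖(1 - (t : ℂ) • Q + z • R) k‖ := by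
    intro t h0 h1 k
    have h5 := norm_sq_le_of_symmetric_pair (R := R) (L := 1 - (t : ℂ) • Q) (fun k l => by
      simp [hQR, hR]) hz k
    have h6 : ‖k - (t : ℂ) • Q k‖ ≤ 2 * ‖(1 - (t : ℂ) • Q + z • R) k‖ := by
      have : k - (t : ℂ) • Q k = (1 - (t : ℂ) • Q + z • R) k - z • R k := by simp
      rw [this]
      refine (norm_sub_le _ _).trans ?_
      rw [norm_smul, hz1]
      linarith
    calc ‖Q k‖ ≤ a * ‖R k‖ + b * ‖k - (t : ℂ) • Q k‖ := hQ t h0 h1 k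
      _ ≤ a * ‖(1 - (t : ℂ) • Q + z • R) k‖ + b * (2 * ‖(1 - (t : ℂ) • Q + z • R) k‖) := by gcongr
      _ = m * ‖(1 - (t : ℂ) • Q + z • R) k‖ := by rw [hm]; ring
  obtain ⟨n, hn⟩ := exists_nat_gt m
  have hn0 : (0 : ℝ) < n := hm0.trans_lt hn
  have step : ∀ i : ℕ, i ≤ n → IsUnit (1 - ((i / n : ℝ) : ℂ) • Q + z • R) := by
    intro i
    induction i with
    | zero => intro _; simpa using isUnit_one_add_smul_of_isSymmetric hR hz
    | succ i ih =>
      intro hi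
      obtain ⟨U, hU⟩ := ih (by omega)
      set t : ℝ := i / n with ht
      have ht1 : t ≤ 1 := by
        rw [ht, div_le_one hn0]; exact_mod_cast (by omega : i ≤ n)
      set V : K →L[ℂ] K := (↑U⁻¹ : K →L[ℂ] K) with hV
      have hVU : V * U = 1 := U.inv_mul
      have hUV : (U : K →L[ℂ] K) * V = 1 := U.mul_inv
      have hs : (((i + 1 : ℕ) / n : ℝ) : ℂ) = (t : ℂ) + ((1 / n : ℝ) : ℂ) := by
        rw [ht]; push_cast; ring
      have h1 : 1 - (((i + 1 : ℕ) / n : ℝ) : ℂ) • Q + z • R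
          = (1 - ((1 / n : ℝ) : ℂ) • (Q * V)) * U := by
        rw [sub_mul, smul_mul_assoc, mul_assoc, hVU, hs, hU, add_smul]
        simp; abel
      rw [h1]
      refine IsUnit.mul ?_ U.isUnit
      refine isUnit_one_sub_of_norm_lt_one ?_
      have hQV : ‖Q * V‖ ≤ m := by
        refine ContinuousLinearMap.opNorm_le_bound _ hm0 fun k => ?_
        have := key t (by positivity) ht1 (V k)
        rw [← hU] at this
        change _ ≤ m * ‖((U : K →L[ℂ] K) * V) k‖ at this
        rw [hUV] at this
        exact this
      rw [norm_smul, Complex.norm_real, Real.norm_of_nonneg (by positivity), one_div_mul_eq_div,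
        div_lt_one hn0]
      exact hQV.trans_lt hn
  have := step n le_rfl
  rwa [div_self hn0.ne', Complex.ofReal_one, one_smul] at this

end Abstract

/-! ### Resolvents of restrictions of T -/

section Resolvents

variable {H : Type*} [NormedAddCommGroup H] [InnerProductSpace ℂ H]
variable {T : H →ₗ.[ℂ] H}

lemma shift_apply (z : ℂ) (f : T.domain) : shift T z f = T f - z • (f : H) := rfl

/-- The resolvent `(T ↾ S - z)⁻¹ : H → dom T`. -/
def restrResolvent {S : Submodule ℂ T.domain} {z : ℂ} (hz : z ∈ resolventSet (restr T S)) :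
    H →ₗ[ℂ] T.domain :=
  restrIncl T S ∘ₗ (resolvent hz).toLinearMap

variable {S : Submodule ℂ T.domain} {z : ℂ} (hz : z ∈ resolventSet (restr T S))

lemma restrResolvent_mem (h : H) : restrResolvent hz h ∈ S := restrIncl_mem T S _

lemma shift_restrResolvent (h : H) : shift T z (restrResolvent hz h) = h :=
  (LinearEquiv.ofBijective (shift (restr T S) z) hz.1).apply_symm_apply h

lemma apply_restrResolvent (h : H) :
    T (restrResolvent hz h) = h + z • (restrResolvent hz h : H) := by
  have := shift_restrResolvent hz h
  rwa [shift_apply, sub_eq_iff_eq_add] at this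

lemma restrResolvent_shift {f : T.domain} (hf : f ∈ S) : restrResolvent hz (shift T z f) = f := by
  set f' : (restr T S).domain := ⟨f, Submodule.mem_map_of_mem (f := T.domain.subtype) hf⟩
  have : resolvent hz (shift T z f) = f' :=
    (LinearEquiv.ofBijective (shift (restr T S) z) hz.1).symm_apply_apply f'
  change restrIncl T S (resolvent hz (shift T z f)) = f
  rw [this]
  rfl

/-- The resolvent of `T ↾ S` as a bounded operator in `H`. -/
def restrResolventCLM : H →L[ℂ] H where
  toLinearMap := T.domain.subtype ∘ₗ restrResolvent hz
  cont := by
    obtain ⟨C, hC⟩ := hz.2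
    refine AddMonoidHomClass.continuous_of_bound
      (T.domain.subtype ∘ₗ restrResolvent hz) C fun h => ?_
    have := hC (resolvent hz h)
    rwa [show shift (restr T S) z (resolvent hz h) = h from shift_restrResolvent hz h] at this

lemma restrResolventCLM_apply (h : H) : restrResolventCLM hz h = restrResolvent hz h := rfl

lemma inner_restrResolventCLM {η : ℝ} (hη : (η : ℂ) ∈ resolventSet (restr T S))
    (hS : ∀ f ∈ S, ∀ g ∈ S, inner ℂ (T f) (g : H) = inner ℂ (f : H) (T g)) (h k : H) :
    inner ℂ (restrResolventCLM hη h) k = inner ℂ h (restrResolventCLM hη k) := by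
  have := hS _ (restrResolvent_mem hη h) _ (restrResolvent_mem hη k)
  rw [apply_restrResolvent, apply_restrResolvent, inner_add_left, inner_add_right, inner_smul_left,
    inner_smul_right, Complex.conj_ofReal] at this
  exact (add_right_cancel this).symm

/-- The resolvent identity, kept with values in dom T so that boundary maps can be applied: it
carries continuity from one point of the resolvent set to all others. -/
lemma restrResolvent_eq {w : ℂ} (hw : w ∈ resolventSet (restr T S)) (h : H) :
    restrResolvent hw h = restrResolvent hz (h + (w - z) • restrResolventCLM hw h) := by
  rw [← restrResolvent_shift hz (restrResolvent_mem hw h), shift_apply, apply_restrResolvent,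
    restrResolventCLM_apply, sub_smul, add_sub_assoc]

end Resolvents

/-! ### Boundary maps, Weyl function and the closure of ker(T - z) -/

section Triples

variable {H : Type*} [NormedAddCommGroup H] [InnerProductSpace ℂ H]
variable {G : Type*} [NormedAddCommGroup G] [InnerProductSpace ℂ G]
variable {T : H →ₗ.[ℂ] H}

lemma coe_boundaryResolvent (Γ Γ' : T.domain →ₗ[ℂ] G) {z : ℂ}
    (hz : z ∈ resolventSet (restr T Γ'.ker)) (h : H) :
    (boundaryResolvent Γ Γ' hz h : G) = Γ (restrResolvent hz h) := rfl

/-- The operator `Γ (T ↾ ker Γ' - z)⁻¹` with values in `ran (Γ ↾ ker Γ')`, equipped with an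
admissible norm, is bounded for every `z`. -/
lemma IsAdmissible.continuous {Γ Γ' : T.domain →ₗ[ℂ] G} {N : EmbeddedNorm (kerRange Γ Γ')}
    (hN : IsAdmissible Γ Γ' N) {w : ℂ} (hw : w ∈ resolventSet (restr T Γ'.ker)) :
    Continuous fun h : H => N.toSub.symm (boundaryResolvent Γ Γ' hw h) := by
  obtain ⟨z, hz, hc⟩ := hN.continuous_resolvent
  have h1 : (fun h : H => N.toSub.symm (boundaryResolvent Γ Γ' hw h)) = fun h =>
      N.toSub.symm (boundaryResolvent Γ Γ' hz (h + (w - z) • restrResolventCLM hw h)) := by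
    funext h
    congr 1
    ext
    rw [coe_boundaryResolvent, coe_boundaryResolvent, ← restrResolvent_eq]
  rw [h1]
  exact hc.comp (by fun_prop)

/-- `Γ (T ↾ ker Γ' - z)⁻¹` as a bounded operator. -/
def boundaryResolventCLM {Γ Γ' : T.domain →ₗ[ℂ] G} {N : EmbeddedNorm (kerRange Γ Γ')}
    (hN : IsAdmissible Γ Γ' N) {z : ℂ} (hz : z ∈ resolventSet (restr T Γ'.ker)) :
    H →L[ℂ] N.Space where
  toLinearMap := N.toSub.symm.toLinearMap ∘ₗ boundaryResolvent Γ Γ' hz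
  cont := hN.continuous hz

lemma EmbeddedNorm.incl_injective {p : Submodule ℂ G} (N : EmbeddedNorm p) :
    Function.Injective N.incl := Subtype.val_injective

lemma mem_defect_iff {z : ℂ} {f : T.domain} : f ∈ defect T z ↔ T f = z • (f : H) := by
  rw [defect, LinearMap.mem_ker, shift_apply, sub_eq_zero]

lemma weyl_apply (Γ₀ Γ₁ : T.domain →ₗ[ℂ] G) {z : ℂ} (hz : z ∈ resolventSet (restr T Γ₀.ker))
    {g : T.domain} (hg : g ∈ defect T z) (x : (weyl Γ₀ Γ₁ hz).domain) (hx : (x : G) = Γ₀ g) :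
    weyl Γ₀ Γ₁ hz x = Γ₁ g := by
  have h1 : gammaField Γ₀ hz x = ⟨g, hg⟩ :=
    (LinearEquiv.symm_apply_eq (LinearEquiv.ofBijective _ (bijective_on_defect Γ₀ hz))).2
      (Subtype.ext hx)
  change Γ₁ (gammaField Γ₀ hz x : T.domain) = _
  rw [h1]

/-- The closure of `ker (T - z)` in `H`. -/
def defectClosure (T : H →ₗ.[ℂ] H) (z : ℂ) : Submodule ℂ H :=
  ((defect T z).map T.domain.subtype).topologicalClosure

lemma coe_mem_defectClosure {z : ℂ} {f : T.domain} (hf : f ∈ defect T z) :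
    (f : H) ∈ defectClosure T z :=
  Submodule.le_topologicalClosure _ (Submodule.mem_map_of_mem (f := T.domain.subtype) hf)

lemma mem_orthogonal_defectClosure {z : ℂ} {h : H}
    (hh : ∀ g ∈ defect T z, inner ℂ h (g : H) = 0) : h ∈ (defectClosure T z)ᗮ := by
  rw [defectClosure, Submodule.orthogonal_closure, Submodule.mem_orthogonal']
  rintro _ ⟨g, hg, rfl⟩
  exact hh g hg

lemma inner_defect_of_mem_orthogonal {z : ℂ} {h : H} (hh : h ∈ (defectClosure T z)ᗮ)
    {g : T.domain} (hg : g ∈ defect T z) : inner ℂ h (g : H) = 0 :=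
  (Submodule.mem_orthogonal' _ _).1 hh _ (coe_mem_defectClosure hg)

/-- If `(g, g')` is in the closure of the graph of `T`, then `g - (T ↾ S - z)⁻¹ (g' - z g)` is in the
closure of `ker (T - z)`. -/
lemma sub_restrResolventCLM_mem_defectClosure {S : Submodule ℂ T.domain} {z : ℂ}
    (hz : z ∈ resolventSet (restr T S)) {g g' : H} (hg : (g, g') ∈ T.graph.topologicalClosure) :
    g - restrResolventCLM hz (g' - z • g) ∈ defectClosure T z := by
  refine map_mem_closure (f := fun p : H × H => p.1 - restrResolventCLM hz (p.2 - z • p.1))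
    (by fun_prop) hg ?_
  rintro ⟨f, f'⟩ hf
  obtain ⟨f, rfl, rfl⟩ := LinearPMap.mem_graph_iff _ |>.1 hf
  refine ⟨f - restrResolvent hz (T f - z • (f : H)), ?_, rfl⟩
  change shift T z _ = 0
  rw [map_sub, shift_restrResolvent, shift_apply, sub_self]

/-- The element `(T ↾ S - z)⁻¹ h - (T ↾ S' - z)⁻¹ h` of `ker (T - z)`. -/
lemma restrResolvent_sub_mem_defect {S S' : Submodule ℂ T.domain} {z : ℂ}
    (hz : z ∈ resolventSet (restr T S)) (hz' : z ∈ resolventSet (restr T S')) (h : H) :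
    restrResolvent hz h - restrResolvent hz' h ∈ defect T z := by
  change shift T z _ = 0
  rw [map_sub, shift_restrResolvent, shift_restrResolvent, sub_self]

end Triples

/-! ### Self-adjointness criterion and consequences of Green's identity -/

section SelfAdjoint

variable {H : Type*} [NormedAddCommGroup H] [InnerProductSpace ℂ H] [CompleteSpace H]

/-- By symmetry the operator is contained in its adjoint, so only domains need comparison; `hm` says
this with weak pairs (g, g') and need not identify g'. -/
lemma isSelfAdjoint_restr {T : H →ₗ.[ℂ] H} {S : Submodule ℂ T.domain}
    (hd : Dense ((restr T S).domain : Set H))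
    (hs : ∀ f ∈ S, ∀ g ∈ S, inner ℂ (T f) (g : H) = inner ℂ (f : H) (T g))
    (hm : ∀ g g' : H, (∀ f ∈ S, inner ℂ (T f) g = inner ℂ (f : H) g') → ∃ f ∈ S, (f : H) = g) :
    IsSelfAdjoint (restr T S) := by
  have hle : restr T S ≤ (restr T S).adjoint :=
    LinearPMap.IsFormalAdjoint.le_adjoint hd fun f g =>
      hs _ (restrIncl_mem T S f) _ (restrIncl_mem T S g)
  rw [LinearPMap.isSelfAdjoint_def]
  refine (LinearPMap.eq_of_le_of_domain_eq hle (le_antisymm hle.1 fun g hg => ?_)).symm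
  obtain ⟨f, hf, rfl⟩ := hm g ((restr T S).adjoint ⟨g, hg⟩) fun f hf => by
    have := LinearPMap.adjoint_isFormalAdjoint hd ⟨g, hg⟩
      ⟨f, Submodule.mem_map_of_mem (f := T.domain.subtype) hf⟩
    rw [← inner_conj_symm, ← inner_conj_symm (f : H), this]
    rfl
  exact Submodule.mem_map_of_mem (f := T.domain.subtype) hf

variable {G : Type*} [NormedAddCommGroup G] [InnerProductSpace ℂ G]
variable {A T : H →ₗ.[ℂ] H} {Γ₀ Γ₁ : T.domain →ₗ[ℂ] G}

namespace IsQuasiBoundaryTriple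

variable (hΓ : IsQuasiBoundaryTriple A T Γ₀ Γ₁)
include hΓ

lemma mem_closure_graph (hd : Dense (A.domain : Set H)) {g g' : H}
    (h : ∀ f : A.domain, inner ℂ (A f) g = inner ℂ (f : H) g') :
    (g, g') ∈ T.graph.topologicalClosure := by
  have hc : T.IsClosable := (LinearPMap.adjoint_isClosed hd).isClosable.leIsClosable hΓ.le_adjoint
  have h1 : ∀ f : A.domain, inner ℂ g' (f : H) = inner ℂ g (A f) := fun f => by
    rw [← inner_conj_symm, ← h, inner_conj_symm]
  have hg : g ∈ A.adjoint.domain := LinearPMap.mem_adjoint_domain_of_exists g ⟨g', h1⟩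
  rw [hc.graph_closure_eq_closure_graph, hΓ.closure_eq, LinearPMap.mem_graph_iff]
  exact ⟨⟨g, hg⟩, rfl, LinearPMap.adjoint_apply_eq hd ⟨g, hg⟩ h1⟩

/-- `A` is the restriction of `T` to a subspace of `ker Γ₀ ∩ ker Γ₁`. -/
lemma exists_of_mem_domain (hd : Dense (A.domain : Set H)) (f : A.domain) :
    ∃ g : T.domain, (g : H) = f ∧ T g = A f ∧ Γ₀ g = 0 ∧ Γ₁ g = 0 := by
  have hT : ∀ g : T.domain, inner ℂ (A f) (g : H) = inner ℂ (f : H) (T g) := fun g => by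
    have h1 : T g = A.adjoint ⟨g, hΓ.le_adjoint.1 g.2⟩ := hΓ.le_adjoint.2 rfl
    have h2 := LinearPMap.adjoint_isFormalAdjoint hd ⟨g, hΓ.le_adjoint.1 g.2⟩ f
    rw [h1, ← inner_conj_symm, ← inner_conj_symm (f : H), h2]
  have h1 : ∀ g : (restr T Γ₀.ker).domain,
      inner ℂ (A f) (g : H) = inner ℂ (f : H) (restr T Γ₀.ker g) := fun g =>
    hT (restrIncl T _ g)
  have h2 : (f : H) ∈ (restr T Γ₀.ker).domain := by
    -- A₀ ⊂ T ⊂ A* makes f an element of dom A₀* = dom A₀.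
    rw [← LinearPMap.isSelfAdjoint_def.1 hΓ.selfAdjoint]
    exact LinearPMap.mem_adjoint_domain_of_exists _ ⟨_, h1⟩
  obtain ⟨g, hg, hgf⟩ := h2
  have hgf' : (g : H) = f := hgf
  have h0 : Γ₀ g = 0 := hg
  have hTg : T g = A f := by
    have h3 : (restr T Γ₀.ker).adjoint = restr T Γ₀.ker :=
      LinearPMap.isSelfAdjoint_def.1 hΓ.selfAdjoint
    have h4 : (f : H) ∈ (restr T Γ₀.ker).adjoint.domain :=
      LinearPMap.mem_adjoint_domain_of_exists _ ⟨_, h1⟩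
    have h5 := LinearPMap.adjoint_apply_eq hΓ.selfAdjoint.dense_domain ⟨f, h4⟩ h1
    rw [← h5]
    symm
    exact h3.le.2 (y := ⟨g, Submodule.mem_map_of_mem (f := T.domain.subtype) hg⟩) hgf'.symm
  refine ⟨g, hgf', hTg, h0, ?_⟩
  -- As Γ₀g = 0, Green's identity leaves only this term; density of ran Γ then forces Γ₁g = 0.
  have h6 : ∀ g' : T.domain, inner ℂ (Γ₁ g) (Γ₀ g') = 0 := fun g' => by
    have := hΓ.green g g'
    rw [hTg, hgf', hT, sub_self, h0, inner_zero_left, sub_zero] at this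
    exact this.symm
  have h7 : (fun p : G × G => inner ℂ (Γ₁ g) p.1) = fun _ => (0 : ℂ) :=
    hΓ.denseRange.equalizer (by fun_prop) (by fun_prop) (funext fun g' => h6 g')
  exact inner_self_eq_zero.1 (congrFun h7 (Γ₁ g, 0))

lemma symm_ker₀ : ∀ f ∈ Γ₀.ker, ∀ g ∈ Γ₀.ker, inner ℂ (T f) (g : H) = inner ℂ (f : H) (T g) := by
  intro f hf g hg
  rw [← sub_eq_zero, hΓ.green, LinearMap.mem_ker.1 hf, LinearMap.mem_ker.1 hg]
  simp

lemma symm_ker₁ : ∀ f ∈ Γ₁.ker, ∀ g ∈ Γ₁.ker, inner ℂ (T f) (g : H) = inner ℂ (f : H) (T g) := by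
  intro f hf g hg
  rw [← sub_eq_zero, hΓ.green, LinearMap.mem_ker.1 hf, LinearMap.mem_ker.1 hg]
  simp

variable {η : ℝ} (hη₀ : (η : ℂ) ∈ resolventSet (restr T Γ₀.ker))

/-- `Γ₁ (A₀ - η)⁻¹` is the adjoint of `γ(η)`. -/
lemma inner_restrResolvent_defect (h : H) {g : T.domain} (hg : g ∈ defect T η) :
    inner ℂ (Γ₁ (restrResolvent hη₀ h)) (Γ₀ g) = inner ℂ h (g : H) := by
  have h0 : Γ₀ (restrResolvent hη₀ h) = 0 := restrResolvent_mem hη₀ h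
  have := hΓ.green (restrResolvent hη₀ h) g
  rw [h0, inner_zero_left, sub_zero] at this
  rw [← this, apply_restrResolvent, mem_defect_iff.1 hg, inner_add_left, inner_smul_left,
    inner_smul_right, Complex.conj_ofReal, add_sub_cancel_right]

/-- Since dom T = ker Γ₀ + ker(T - η), Γ₀ maps ker(T - η) onto ran Γ₀, which is dense; so the kernel
of γ(η)* is orthogonal to ker(T - η). -/
lemma restrResolvent_eq_zero_of_mem_orthogonal {h : H} (hh : h ∈ (defectClosure T (η : ℂ))ᗮ) :
    Γ₁ (restrResolvent hη₀ h) = 0 := by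
  have h6 : ∀ f : T.domain, inner ℂ (Γ₁ (restrResolvent hη₀ h)) (Γ₀ f) = 0 := fun f => by
    have hg : f - restrResolvent hη₀ (shift T η f) ∈ defect T (η : ℂ) := by
      change shift T η _ = 0
      rw [map_sub, shift_restrResolvent, sub_self]
    have h0 : Γ₀ (restrResolvent hη₀ (shift T η f)) = 0 := restrResolvent_mem hη₀ _
    have := hΓ.inner_restrResolvent_defect hη₀ h hg
    rwa [map_sub, h0, sub_zero, inner_defect_of_mem_orthogonal hh hg] at this
  have h7 : (fun p : G × G => inner ℂ (Γ₁ (restrResolvent hη₀ h)) p.1) = fun _ => (0 : ℂ) :=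
    hΓ.denseRange.equalizer (by fun_prop) (by fun_prop) (funext fun g' => h6 g')
  exact inner_self_eq_zero.1 (congrFun h7 (Γ₁ (restrResolvent hη₀ h), 0))

lemma mem_orthogonal_of_restrResolvent_eq_zero {h : H} (hh : Γ₁ (restrResolvent hη₀ h) = 0) :
    h ∈ (defectClosure T (η : ℂ))ᗮ :=
  mem_orthogonal_defectClosure fun g hg => by
    rw [← hΓ.inner_restrResolvent_defect hη₀ h hg, hh, inner_zero_left]

instance : CompleteSpace (defectClosure T (η : ℂ)) :=
  (Submodule.isClosed_topologicalClosure _).completeSpace_coe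

/-- `Γ₁ (A₀ - η)⁻¹` is an isomorphism from the closure of `ker (T - η)` onto `ran (Γ₁ ↾ ker Γ₀)`. -/
lemma exists_equiv {N₁ : EmbeddedNorm (kerRange Γ₁ Γ₀)} (hN₁ : IsAdmissible Γ₁ Γ₀ N₁) :
    ∃ e : defectClosure T (η : ℂ) ≃L[ℂ] N₁.Space,
      ∀ k, N₁.incl (e k) = Γ₁ (restrResolvent hη₀ k) := by
  have := hN₁.complete
  set L : defectClosure T (η : ℂ) →L[ℂ] N₁.Space :=
    (boundaryResolventCLM hN₁ hη₀).comp (Submodule.subtypeL _)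
  have hLk : ∀ k, N₁.incl (L k) = Γ₁ (restrResolvent hη₀ (k : H)) := fun k => rfl
  refine ⟨ContinuousLinearEquiv.ofBijective L ?_ ?_, fun k => ?_⟩
  · rw [LinearMap.ker_eq_bot']
    intro k hk
    have h1 : Γ₁ (restrResolvent hη₀ (k : H)) = 0 := by
      rw [← hLk]
      exact (congrArg N₁.incl hk).trans (map_zero _)
    have h2 := hΓ.mem_orthogonal_of_restrResolvent_eq_zero hη₀ h1
    exact Subtype.ext (inner_self_eq_zero.1 (Submodule.inner_right_of_mem_orthogonal k.2 h2))
  · rw [LinearMap.range_eq_top]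
    intro y
    obtain ⟨f, hf, hfy⟩ : N₁.incl y ∈ kerRange Γ₁ Γ₀ := (N₁.toSub y).2
    set h : H := shift T η f with hh
    -- The component of h orthogonal to K does not contribute to Γ₁(A₀ - η)⁻¹h, so projecting loses
    -- nothing.
    refine ⟨(defectClosure T (η : ℂ)).orthogonalProjectionOnto h, N₁.incl_injective ?_⟩
    have h3 : h - (defectClosure T (η : ℂ)).orthogonalProjectionOnto h ∈ (defectClosure T (η : ℂ))ᗮ :=
      Submodule.sub_starProjection_mem_orthogonal h
    have h4 := hΓ.restrResolvent_eq_zero_of_mem_orthogonal hη₀ h3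
    rw [map_sub, map_sub, hh, restrResolvent_shift hη₀ hf, ← hh, sub_eq_zero] at h4
    rw [← hfy, h4]
    exact hLk _
  · exact hLk k

end IsQuasiBoundaryTriple

end SelfAdjoint

/-! ### Transport of the three conditions on ϑ to K -/

section Perturbation

variable {K : Type*} [NormedAddCommGroup K] [InnerProductSpace ℂ K] [CompleteSpace K]
variable {X Y : Type*} [NormedAddCommGroup X] [NormedSpace ℂ X]
variable [NormedAddCommGroup Y] [NormedSpace ℂ Y]

/-- Perturbations `θ` which are compact, relatively compact or relatively bounded with bound less
than `1` with respect to `M`, in a form where `M` and `θ` are transported to `K`. -/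
lemma exists_isUnit_of_perturbation (e : K ≃L[ℂ] Y) (x : K →L[ℂ] X) (θ M : X →ₗ[ℂ] Y)
    (hM : ∀ k, M (x k) = e k) {R : K →L[ℂ] K}
    (hR : ∀ k l, inner ℂ (R k) l = inner ℂ k (R l))
    (hinj : ∀ k, R k = 0 → k = 0)
    (hθR : ∀ k l, inner ℂ (e.symm (θ (x k))) (R l) = inner ℂ (R k) (e.symm (θ (x l))))
    (ν : X → ℝ) {C : ℝ} (hC : 0 ≤ C) (hν : ∀ k, ν (x k) ≤ C * ‖R k‖)
    (h : IsCompactOperator θ ∨ RelativelyCompact θ M ∨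
      ∃ c₁ c₂ : ℝ, 0 < c₁ ∧ 0 ≤ c₂ ∧ c₂ < 1 ∧ ∀ x, ‖θ x‖ ≤ c₁ * ν x + c₂ * ‖M x‖) :
    ∃ Q : K →L[ℂ] K, (∀ k, Q k = e.symm (θ (x k))) ∧
      ∀ z : ℂ, z = Complex.I ∨ z = -Complex.I → IsUnit (1 - Q + z • R) := by
  set Q₀ : K →ₗ[ℂ] K := e.symm.toLinearMap ∘ₗ θ ∘ₗ x.toLinearMap
  have of_compact : IsCompactOperator Q₀ → ∃ Q : K →L[ℂ] K, (∀ k, Q k = e.symm (θ (x k))) ∧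
      ∀ z : ℂ, z = Complex.I ∨ z = -Complex.I → IsUnit (1 - Q + z • R) := fun hc =>
    ⟨⟨Q₀, hc.continuous⟩, fun _ => rfl, fun z hz => isUnit_of_isCompactOperator hR hθR hinj hc hz⟩
  rcases h with h | h | ⟨c₁, c₂, hc₁, hc₂, hc₂', h⟩
  · exact of_compact ((h.comp_clm x).clm_comp (e.symm : Y →L[ℂ] K))
  · refine of_compact (isCompactOperator_of_subseq Q₀ fun k hk => ?_)
    -- Because M(xk) = ek, the map x is bounded into the graph norm of M, so relative compactness
    -- already makes Q compact.
    obtain ⟨y, φ, hφ, hy⟩ := h (fun n => x (k n))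
      ⟨‖x‖ + ‖(e : K →L[ℂ] Y)‖, fun n => by
        rw [hM]
        exact add_le_add (x.unit_le_opNorm _ (hk n)) ((e : K →L[ℂ] Y).unit_le_opNorm _ (hk n))⟩
    exact ⟨e.symm y, φ, hφ, (e.symm.continuous.tendsto y).comp hy⟩
  · set E := ‖(e : K →L[ℂ] Y)‖
    set F := ‖(e.symm : Y →L[ℂ] K)‖
    have h1 : 0 < 1 - c₂ := by linarith
    -- Writing ek = e(k - tQk) + tθ(xk) puts at most c₂‖θ(xk)‖ on the right of the hypothesis; c₂ <
    -- 1 lets it be absorbed on the left, uniformly in t. The value t = 0 yields continuity of Q.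
    have bound : ∀ t : ℝ, 0 ≤ t → t ≤ 1 → ∀ k,
        ‖Q₀ k‖ ≤ F * (c₁ * C) / (1 - c₂) * ‖R k‖
          + F * (c₂ * E) / (1 - c₂) * ‖k - (t : ℂ) • Q₀ k‖ := by
      intro t ht0 ht1 k
      have h2 : e k = e (k - (t : ℂ) • Q₀ k) + (t : ℂ) • θ (x k) := by
        have : e (Q₀ k) = θ (x k) := e.apply_symm_apply _
        rw [map_sub, map_smul, this, sub_add_cancel]
      have h3 : ‖e k‖ ≤ E * ‖k - (t : ℂ) • Q₀ k‖ + ‖θ (x k)‖ := by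
        rw [h2]
        refine (norm_add_le _ _).trans (add_le_add ((e : K →L[ℂ] Y).le_opNorm _) ?_)
        rw [norm_smul, Complex.norm_real, Real.norm_of_nonneg ht0]
        exact mul_le_of_le_one_left (norm_nonneg _) ht1
      have h4 := h (x k)
      rw [hM] at h4
      have h5 : ‖θ (x k)‖ ≤ (c₁ * C * ‖R k‖ + c₂ * E * ‖k - (t : ℂ) • Q₀ k‖) / (1 - c₂) := by
        rw [le_div_iff₀ h1]
        have h6 := mul_le_mul_of_nonneg_left (hν k) hc₁.le
        have h7 := mul_le_mul_of_nonneg_left h3 hc₂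
        linarith
      calc ‖Q₀ k‖ ≤ F * ‖θ (x k)‖ := (e.symm : Y →L[ℂ] K).le_opNorm _
        _ ≤ F * ((c₁ * C * ‖R k‖ + c₂ * E * ‖k - (t : ℂ) • Q₀ k‖) / (1 - c₂)) := by gcongr
        _ = _ := by ring
    have hcont : Continuous Q₀ := by
      refine AddMonoidHomClass.continuous_of_bound Q₀
        (F * (c₁ * C) / (1 - c₂) * ‖R‖ + F * (c₂ * E) / (1 - c₂)) fun k => ?_
      have := bound 0 le_rfl zero_le_one k
      rw [Complex.ofReal_zero, zero_smul, sub_zero] at this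
      refine this.trans ?_
      rw [add_mul, mul_assoc _ ‖R‖]
      gcongr
      exact R.le_opNorm k
    exact ⟨⟨Q₀, hcont⟩, fun _ => rfl, fun z hz =>
      isUnit_of_relative_bound hR hθR (by positivity) (by positivity) bound hz⟩

end Perturbation

/-! ### Self-adjointness of A_ϑ -/

section Extension

variable {H : Type*} [NormedAddCommGroup H] [InnerProductSpace ℂ H]
variable {G : Type*} [NormedAddCommGroup G] [InnerProductSpace ℂ G]

lemma EmbeddedNorm.antidualNorm_le {p : Submodule ℂ G} (N : EmbeddedNorm p) {x : G} {C : ℝ}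
    (hC : 0 ≤ C) (h : ∀ y : N.Space, ‖inner ℂ (N.incl y) x‖ ≤ C * ‖y‖) : N.antidualNorm x ≤ C :=
  ContinuousLinearMap.opNorm_le_bound _ hC h

variable {T : H →ₗ.[ℂ] H}

/-- The difference of the resolvents of `T ↾ S` and `T ↾ S'` on the closure of `ker (T - z)`. -/
def resolventDifference {S S' : Submodule ℂ T.domain} {z : ℂ}
    (hz : z ∈ resolventSet (restr T S)) (hz' : z ∈ resolventSet (restr T S')) :
    defectClosure T z →L[ℂ] defectClosure T z :=
  ((restrResolventCLM hz - restrResolventCLM hz').comp (Submodule.subtypeL _)).codRestrict _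
    fun k => coe_mem_defectClosure (restrResolvent_sub_mem_defect hz hz' k)

variable [CompleteSpace H] {A : H →ₗ.[ℂ] H} {Γ₀ Γ₁ : T.domain →ₗ[ℂ] G}

theorem IsQuasiBoundaryTriple.isSelfAdjoint_extension
    (hd : Dense (A.domain : Set H)) (hΓ : IsQuasiBoundaryTriple A T Γ₀ Γ₁) {η : ℝ}
    (hη₀ : (η : ℂ) ∈ resolventSet (restr T Γ₀.ker))
    (hη₁ : (η : ℂ) ∈ resolventSet (restr T Γ₁.ker))
    {N₀ : EmbeddedNorm (kerRange Γ₀ Γ₁)} (hN₀ : IsAdmissible Γ₀ Γ₁ N₀)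
    {N₁ : EmbeddedNorm (kerRange Γ₁ Γ₀)} (hN₁ : IsAdmissible Γ₁ Γ₀ N₁)
    {ϑ : G →ₗ.[ℂ] G} (hϑ_symm : ϑ.IsFormalAdjoint ϑ)
    (hϑ_dom : kerRange Γ₀ Γ₁ ≤ ϑ.domain)
    (hϑ_ran : ∀ x (hx : x ∈ kerRange Γ₀ Γ₁), ϑ ⟨x, hϑ_dom hx⟩ ∈ kerRange Γ₁ Γ₀)
    (h : IsCompactOperator (onSpaces N₀ N₁ (between ϑ _ _ hϑ_dom hϑ_ran)) ∨
      RelativelyCompact (onSpaces N₀ N₁ (between ϑ _ _ hϑ_dom hϑ_ran))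
        (onSpaces N₀ N₁ (weylBetween Γ₀ Γ₁ hη₀)) ∨
      ∃ c₁ c₂ : ℝ, 0 < c₁ ∧ 0 ≤ c₂ ∧ c₂ < 1 ∧ ∀ x : N₀.Space,
        ‖onSpaces N₀ N₁ (between ϑ _ _ hϑ_dom hϑ_ran) x‖ ≤ c₁ * N₁.antidualNorm (N₀.incl x)
          + c₂ * ‖onSpaces N₀ N₁ (weylBetween Γ₀ Γ₁ hη₀) x‖) :
    IsSelfAdjoint (extension Γ₀ Γ₁ ϑ) := by
  obtain ⟨e, he⟩ := hΓ.exists_equiv hη₀ hN₁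
  set θ := onSpaces N₀ N₁ (between ϑ _ _ hϑ_dom hϑ_ran)
  set M := onSpaces N₀ N₁ (weylBetween Γ₀ Γ₁ hη₀)
  set R := resolventDifference hη₀ hη₁
  -- The sign comes from Γ₀Rk = -Γ₀(A₁ - η)⁻¹k, the A₀-resolvent being in ker Γ₀.
  set x : defectClosure T (η : ℂ) →L[ℂ] N₀.Space :=
    -(boundaryResolventCLM hN₀ hη₁).comp (Submodule.subtypeL _)
  set g : defectClosure T (η : ℂ) → T.domain := fun k =>
    restrResolvent hη₀ k - restrResolvent hη₁ k with hg
  have hgd : ∀ k, g k ∈ defect T (η : ℂ) := fun k => restrResolvent_sub_mem_defect hη₀ hη₁ k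
  have hgR : ∀ k, (R k : H) = g k := fun k => rfl
  have hg₀ : ∀ k, Γ₀ (g k) = N₀.incl (x k) := fun k => by
    have : Γ₀ (restrResolvent hη₀ (k : H)) = 0 := restrResolvent_mem hη₀ _
    rw [hg, map_sub, this, zero_sub]
    rfl
  have hg₁ : ∀ k, Γ₁ (g k) = N₁.incl (e k) := fun k => by
    have : Γ₁ (restrResolvent hη₁ (k : H)) = 0 := restrResolvent_mem hη₁ _
    rw [hg, map_sub, this, sub_zero, he]
  have mem₀ : ∀ y : N₀.Space, N₀.incl y ∈ kerRange Γ₀ Γ₁ := fun y => (N₀.toSub y).2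
  have hθ : ∀ y, N₁.incl (θ y) = ϑ ⟨N₀.incl y, hϑ_dom (mem₀ y)⟩ := fun y => rfl
  have hM : ∀ k, M (x k) = e k := fun k => by
    apply N₁.incl_injective
    rw [← hg₁]
    exact weyl_apply Γ₀ Γ₁ hη₀ (hgd k) _ (hg₀ k).symm
  have hinner : ∀ k l, inner ℂ k (R l) = inner ℂ (N₁.incl (e k)) (N₀.incl (x l)) := fun k l => by
    rw [he, ← hg₀, hΓ.inner_restrResolvent_defect hη₀ _ (hgd l)]
    rfl
  have hR : ∀ k l, inner ℂ (R k) l = inner ℂ k (R l) := fun k l => by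
    change inner ℂ (restrResolventCLM hη₀ (k : H) - restrResolventCLM hη₁ (k : H)) (l : H)
      = inner ℂ (k : H) (restrResolventCLM hη₀ (l : H) - restrResolventCLM hη₁ (l : H))
    rw [inner_sub_left, inner_sub_right, inner_restrResolventCLM hη₀ hΓ.symm_ker₀,
      inner_restrResolventCLM hη₁ hΓ.symm_ker₁]
  have hinj : ∀ k, R k = 0 → k = 0 := fun k hk => by
    have h1 : g k = 0 := Subtype.ext (by rw [← hgR, hk]; rfl)
    apply e.injective
    apply N₁.incl_injective
    rw [← hg₁, h1]
    simp
  -- Through `hinner` this is (ϑxk, xl) = (xk, ϑxl).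
  have hθR : ∀ k l, inner ℂ (e.symm (θ (x k))) (R l) = inner ℂ (R k) (e.symm (θ (x l))) :=
    fun k l => by
      rw [hinner, ← inner_conj_symm (R k), hinner, e.apply_symm_apply, e.apply_symm_apply, hθ, hθ,
        inner_conj_symm]
      exact hϑ_symm ⟨_, hϑ_dom (mem₀ (x k))⟩ ⟨_, hϑ_dom (mem₀ (x l))⟩
  obtain ⟨Q, hQ, hU⟩ := exists_isUnit_of_perturbation e x θ M hM hR hinj hθR
    (fun y => N₁.antidualNorm (N₀.incl y))
    (norm_nonneg (e.symm : N₁.Space →L[ℂ] defectClosure T (η : ℂ))) (fun k => by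
      refine N₁.antidualNorm_le (by positivity) fun y => ?_
      have h1 := hinner (e.symm y) k
      rw [e.apply_symm_apply] at h1
      rw [← h1]
      calc ‖inner ℂ (e.symm y) (R k)‖ ≤ ‖e.symm y‖ * ‖R k‖ := norm_inner_le_norm _ _
        _ ≤ ‖(e.symm : N₁.Space →L[ℂ] defectClosure T (η : ℂ))‖ * ‖y‖ * ‖R k‖ := by
          gcongr
          exact (e.symm : N₁.Space →L[ℂ] defectClosure T (η : ℂ)).le_opNorm y
        _ = _ := by ring) h
  have hQR : ∀ k l, inner ℂ (Q k) (R l) = inner ℂ (R k) (Q l) := fun k l => by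
    rw [hQ, hQ, hθR]
  have heQ : ∀ k, N₁.incl (e (Q k)) = ϑ ⟨N₀.incl (x k), hϑ_dom (mem₀ _)⟩ := fun k => by
    rw [hQ, e.apply_symm_apply, hθ]
  have mem_graph : ∀ f : T.domain, f ∈ ϑ.graph.comap (Γ₀.prod Γ₁) ↔
      ∃ y : ϑ.domain, (y : G) = Γ₀ f ∧ ϑ y = Γ₁ f := fun f => LinearPMap.mem_graph_iff ϑ
  -- `(A₀ - η)⁻¹ w + R l` is in the domain of `A_ϑ` if `Q l - l = P w`.
  have mem_ext : ∀ (w : H) (l : defectClosure T (η : ℂ)),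
      Γ₁ (restrResolvent hη₀ w) = N₁.incl (e (Q l - l)) →
      restrResolvent hη₀ w + g l ∈ ϑ.graph.comap (Γ₀.prod Γ₁) := fun w l hw => by
    have h0 : Γ₀ (restrResolvent hη₀ w) = 0 := restrResolvent_mem hη₀ _
    rw [mem_graph]
    refine ⟨⟨N₀.incl (x l), hϑ_dom (mem₀ _)⟩, ?_, ?_⟩
    · rw [map_add, h0, zero_add, hg₀]
    · rw [map_add, hw, hg₁, map_sub, map_sub, sub_add_cancel, heQ]
  have T_ext : ∀ (w : H) (l : defectClosure T (η : ℂ)), T (restrResolvent hη₀ w + g l)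
      = w + (η : ℂ) • ((restrResolvent hη₀ w + g l : T.domain) : H) := fun w l => by
    rw [LinearPMap.map_add, apply_restrResolvent, mem_defect_iff.1 (hgd l), Submodule.coe_add,
      smul_add, add_assoc]
  -- Density holds because A ⊂ A_ϑ: elements of dom A have boundary data (0, 0), which lie in every
  -- graph.
  refine isSelfAdjoint_restr (hd.mono ?_) ?_ ?_
  · intro f hf
    obtain ⟨f', hf', -, h0, h1⟩ := hΓ.exists_of_mem_domain hd ⟨f, hf⟩
    refine ⟨f', (mem_graph f').2 ⟨0, ?_, ?_⟩, hf'⟩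
    · rw [h0]; rfl
    · rw [h1, LinearPMap.map_zero]
  · intro f hf f' hf'
    obtain ⟨y, hy0, hy1⟩ := (mem_graph f).1 hf
    obtain ⟨y', hy0', hy1'⟩ := (mem_graph f').1 hf'
    rw [← sub_eq_zero, hΓ.green, ← hy0, ← hy1, ← hy0', ← hy1', sub_eq_zero]
    exact hϑ_symm y y'
  · intro v v' hv
    have hcl : (v, v') ∈ T.graph.topologicalClosure := hΓ.mem_closure_graph hd fun f => by
      obtain ⟨f', hf', hT, h0, h1⟩ := hΓ.exists_of_mem_domain hd f
      rw [← hf', ← hT]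
      refine hv f' ((mem_graph f').2 ⟨0, ?_, ?_⟩)
      · rw [h0]; rfl
      · rw [h1, LinearPMap.map_zero]
    set w : H := v' - (η : ℂ) • v with hw
    set u : defectClosure T (η : ℂ) :=
      ⟨v - restrResolventCLM hη₀ w, sub_restrResolventCLM_mem_defectClosure hη₀ hcl⟩ with hu
    set P := (defectClosure T (η : ℂ)).orthogonalProjectionOnto w
    have hwP : w - P ∈ (defectClosure T (η : ℂ))ᗮ :=
      Submodule.sub_starProjection_mem_orthogonal w
    -- The test elements are (A₀ - η)⁻¹(Qk - k) + Rk ∈ dom A_ϑ; moving the resolvent to the other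
    -- side turns v into u, and w may be projected since Rk ∈ K.
    have huw : ∀ k, inner ℂ (Q k - k) u = inner ℂ (R k) P := fun k => by
      set q : H := ((Q k - k : defectClosure T (η : ℂ)) : H) with hq
      have h1 := hv _ (mem_ext q k (he _).symm)
      rw [T_ext, inner_add_left, inner_smul_left, Complex.conj_ofReal, ← inner_smul_right,
        ← eq_sub_iff_add_eq, ← inner_sub_right, ← hw, Submodule.coe_add, inner_add_left,
        ← restrResolventCLM_apply, inner_restrResolventCLM hη₀ hΓ.symm_ker₀] at h1
      have h2 : inner ℂ (g k : H) (w - P) = 0 :=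
        Submodule.inner_right_of_mem_orthogonal (R k).2 hwP
      rw [inner_sub_right, sub_eq_zero] at h2
      change inner ℂ q (v - restrResolventCLM hη₀ w) = inner ℂ (g k : H) (P : H)
      rw [inner_sub_right, h1, add_sub_cancel_left, h2]
    -- Now u = Rl and Pw = Ql - l, so v = (A₀ - η)⁻¹w + Rl is in dom A_ϑ.
    obtain ⟨l, hl, hl'⟩ := exists_of_forall_inner_eq hR hQR hU huw
    refine ⟨restrResolvent hη₀ w + g l, mem_ext w l ?_, ?_⟩
    · have h3 := hΓ.restrResolvent_eq_zero_of_mem_orthogonal hη₀ hwP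
      rw [map_sub, map_sub, sub_eq_zero] at h3
      rw [hl', he, h3]
    · rw [Submodule.coe_add, ← hgR, hl, hu, ← restrResolventCLM_apply]
      exact add_sub_cancel _ _

end Extension

end QBT

end

theorem mainTheorem12
    {H : Type*} [NormedAddCommGroup H] [InnerProductSpace ℂ H] [CompleteSpace H]
    {G : Type*} [NormedAddCommGroup G] [InnerProductSpace ℂ G] [CompleteSpace G]
    (A T : H →ₗ.[ℂ] H)
    (hA_dense : Dense (A.domain : Set H)) (hA_closed : A.IsClosed)
    (hA_symm : A.IsFormalAdjoint A)
    (Γ₀ Γ₁ : T.domain →ₗ[ℂ] G)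
    (hΓ : QBT.IsQuasiBoundaryTriple A T Γ₀ Γ₁)
    (hA₁ : IsSelfAdjoint (QBT.restr T Γ₁.ker))
    (η : ℝ)
    (hη₀ : (η : ℂ) ∈ QBT.resolventSet (QBT.restr T Γ₀.ker))
    (hη₁ : (η : ℂ) ∈ QBT.resolventSet (QBT.restr T Γ₁.ker))
    (hG₀ : Dense (QBT.kerRange Γ₀ Γ₁ : Set G))
    (hG₁ : Dense (QBT.kerRange Γ₁ Γ₀ : Set G))
    (N₀ : QBT.EmbeddedNorm (QBT.kerRange Γ₀ Γ₁)) (hN₀ : QBT.IsAdmissible Γ₀ Γ₁ N₀)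
    (N₁ : QBT.EmbeddedNorm (QBT.kerRange Γ₁ Γ₀)) (hN₁ : QBT.IsAdmissible Γ₁ Γ₀ N₁)
    (ϑ : G →ₗ.[ℂ] G) (hϑ_symm : ϑ.IsFormalAdjoint ϑ)
    (hϑ_dom : QBT.kerRange Γ₀ Γ₁ ≤ ϑ.domain)
    (hϑ_ran : ∀ x (hx : x ∈ QBT.kerRange Γ₀ Γ₁), ϑ ⟨x, hϑ_dom hx⟩ ∈ QBT.kerRange Γ₁ Γ₀)
    (h :
      IsCompactOperator
          (QBT.onSpaces N₀ N₁ (QBT.between ϑ _ _ hϑ_dom hϑ_ran)) ∨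
      QBT.RelativelyCompact
          (QBT.onSpaces N₀ N₁ (QBT.between ϑ _ _ hϑ_dom hϑ_ran))
          (QBT.onSpaces N₀ N₁ (QBT.weylBetween Γ₀ Γ₁ hη₀)) ∨
      ∃ c₁ c₂ : ℝ, 0 < c₁ ∧ 0 ≤ c₂ ∧ c₂ < 1 ∧
        ∀ x : N₀.Space,
          ‖QBT.onSpaces N₀ N₁ (QBT.between ϑ _ _ hϑ_dom hϑ_ran) x‖
            ≤ c₁ * N₁.antidualNorm (N₀.incl x)
              + c₂ * ‖QBT.onSpaces N₀ N₁ (QBT.weylBetween Γ₀ Γ₁ hη₀) x‖) :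
    IsSelfAdjoint (QBT.extension Γ₀ Γ₁ ϑ) :=
  hΓ.isSelfAdjoint_extension hA_dense hη₀ hη₁ hN₀ hN₁ hϑ_symm hϑ_dom hϑ_ran h
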